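/- \textbf{Lemma (Homotopy lemma).} All graphs are finite and simple; the empty graph is allowed. For graphs $G=(V,E)$ and $H=(W,F)$, the \emph{strong product} $G\boxtimes H$ is the graph with vertex set $V\times W$ in which two distinct vertices $(a,b)$, $(c,d)$ are adjacent if and only if ($a=c$ or $\{a,c\}\in E$) and ($b=d$ or $\{b,d\}\in F$). A \emph{simplex} of a graph is a nonempty set of pairwise adjacent vertices. The \emph{Cartesian simplex product} $G\times H$ is the graph whose vertices are the pairs $(x,y)$ of a simplex $x$ of $G$ and a simplex $y$ of $H$, two distinct pairs $(x,y)$, $(x',y')$ being adjacent if and only if one is contained in the other, that is, $x\subseteq x'$ and $y\subseteq y'$, or $x'\subseteq x$ and $y'\subseteq y$. The \emph{unit sphere} $S(x)$ of a vertex $x$ of a graph $G$ is the subgraph induced on the neighbours of $x$, and $G\setminus x$ is the subgraph induced on the vertices different from $x$. \emph{Collapsible} graphs are defined inductively: the one-point graph $K_1$ is collapsible, and a graph $G$ is collapsible if it has a vertex $x$ for which both $S(x)$ and $G\setminus x$ are collapsible. A \emph{homotopy step} either removes a vertex whose unit sphere is collapsible, or is a cone extension over a collapsible induced subgraph $A$,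 that is, adds one new vertex joined exactly to the vertices of $A$. Two graphs are \emph{homotopic} if they are related by the equivalence relation generated by isomorphism and homotopy steps. Then for all finite simple graphs $G$ and $H$, the graph $G\boxtimes H$ is homotopic to the graph $G\times H$. -/

import Mathlib

namespace SimpleGraph

universe u v

/-- Direct (tensor) product: both coordinates are adjacent. -/
def tensorProd {V : Type u} {W : Type v} (G : SimpleGraph V) (H : SimpleGraph W) :
    SimpleGraph (V × W) where
  Adj p q := G.Adj p.1 q.1 ∧ H.Adj p.2 q.2
  symm := ⟨fun _ _ h => ⟨h.1.symm, h.2.symm⟩⟩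
  loopless := ⟨fun p h => G.loopless.irrefl p.1 h.1⟩

/-- Strong (Sabidussi) product: the edge set is the union of the edge sets of the weak
product `G □ H` and of the direct product. -/
def strongProd {V : Type u} {W : Type v} (G : SimpleGraph V) (H : SimpleGraph W) :
    SimpleGraph (V × W) :=
  G.boxProd H ⊔ G.tensorProd H

/-- The simplices of a graph: nonempty finite sets of pairwise adjacent vertices. -/
abbrev Simplex {V : Type u} (G : SimpleGraph V) : Type u :=
  {s : Finset V // s.Nonempty ∧ G.IsClique (s : Set V)}

/-- Cartesian simplex product: the vertices are the pairs `(x, y)` of a simplex `x` of `G` and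
a simplex `y` of `H`; two different pairs are adjacent if one is contained in the other. -/
def simplexProd {V : Type u} {W : Type v} (G : SimpleGraph V) (H : SimpleGraph W) :
    SimpleGraph (G.Simplex × H.Simplex) where
  Adj p q := p ≠ q ∧
    ((p.1.1 ⊆ q.1.1 ∧ p.2.1 ⊆ q.2.1) ∨ (q.1.1 ⊆ p.1.1 ∧ q.2.1 ⊆ p.2.1))
  symm := ⟨fun _ _ h => ⟨h.1.symm, h.2.symm⟩⟩
  loopless := ⟨fun _ h => h.1 rfl⟩

/-- The unit sphere `S(x)`: the subgraph induced on the neighbours of `x`. -/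
abbrev unitSphere {V : Type u} (G : SimpleGraph V) (x : V) : SimpleGraph (G.neighborSet x) :=
  G.induce (G.neighborSet x)

/-- `G` with the vertex `x` removed. -/
abbrev deleteVertex {V : Type u} (G : SimpleGraph V) (x : V) :
    SimpleGraph (({x} : Set V)ᶜ : Set V) :=
  G.induce ({x} : Set V)ᶜ

/-- Cone extension of `G` over the subgraph induced on `A`: a new vertex `none` is added and
joined exactly to the vertices in `A`. -/
def coneExtension {V : Type u} (G : SimpleGraph V) (A : Set V) : SimpleGraph (Option V) where
  Adj
    | none, none => False
    | none, some w => w ∈ A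
    | some v, none => v ∈ A
    | some v, some w => G.Adj v w
  symm := ⟨by
    rintro (_ | v) (_ | w) h
    · exact h
    · exact h
    · exact h
    · exact G.symm.symm v w h⟩
  loopless := ⟨by
    rintro (_ | v) h
    · exact h
    · exact G.loopless.irrefl v h⟩

/-- Collapsible graphs: the one-point graph is collapsible, and a graph is collapsible if it has
a vertex `x` such that both `S(x)` and `G` without `x` are collapsible. -/
inductive Collapsible : ∀ {V : Type u}, SimpleGraph V → Prop
  | point {V : Type u} (G : SimpleGraph V) (x : V) (hx : ∀ y : V, y = x) : Collapsible G
  | step {V : Type u} (G : SimpleGraph V) (x : V) (hS : Collapsible (G.unitSphere x))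
      (hD : Collapsible (G.deleteVertex x)) : Collapsible G

/-- Homotopy of graphs: the equivalence relation generated by isomorphism and the two homotopy
steps, removal of a vertex with collapsible unit sphere and cone extension over a collapsible
subgraph. -/
inductive Homotopic : ∀ {V W : Type u}, SimpleGraph V → SimpleGraph W → Prop
  | iso {V W : Type u} {G : SimpleGraph V} {H : SimpleGraph W} (e : G ≃g H) : Homotopic G H
  | delete {V : Type u} (G : SimpleGraph V) (x : V) (h : Collapsible (G.unitSphere x)) :
      Homotopic G (G.deleteVertex x)
  | cone {V : Type u} (G : SimpleGraph V) (A : Set V) (h : Collapsible (G.induce A)) :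
      Homotopic G (G.coneExtension A)
  | symm {V W : Type u} {G : SimpleGraph V} {H : SimpleGraph W} (h : Homotopic G H) :
      Homotopic H G
  | trans {V W X : Type u} {G : SimpleGraph V} {H : SimpleGraph W} {K : SimpleGraph X}
      (h₁ : Homotopic G H) (h₂ : Homotopic H K) : Homotopic G K

end SimpleGraph

/-!
Both graphs are deformed inside one larger graph. Let `K = G ⊠ H` and let `P` be the poset of
pairs `(x, y)` of a simplex of `G` and a simplex of `H`; its comparability graph is the Cartesian
simplex product. A pair `(x, y)` spans the rectangle `x ×ˢ y`, a nonempty clique of `K`, and every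
nonempty clique of `K` lies in a smallest rectangle, the one spanned by its two projections. Glue
`K` to the comparability graph of `P` by joining each vertex to the rectangles that contain it.

* Rectangles can be removed one by one, a minimal remaining one first
  (`homotopic_incidence_left`): the unit sphere of `p` then consists of the vertices of `p` and of
  rectangles larger than `p`, and is a cone whose apex is any vertex of `p`.
* Vertices of `K` can be removed one by one in any order (`homotopic_incidence_right`): the unit
  sphere of `a` consists of neighbours of `a` in `K` and the rectangles containing `a`. More
  generally, for a nonempty clique `σ`, any set of common neighbours of `σ` together with all
  rectangles containing `σ` spans a collapsible graph (`collapsible_incidence`). This goes by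
  induction on the number of common neighbours: the sphere of one of them, `b`, has the same shape
  for the clique `σ ∪ {b}`, and once none is left, the smallest rectangle containing `σ` is the
  apex of a cone.
-/

namespace SimpleGraph

universe u v

section Collapse

variable {V : Type u}

/-! ### Collapsibility and homotopy of induced subgraphs -/

/-- The subgraphs induced on `s` and `t` are isomorphic if `t` is the image of `s` under an
embedding of graphs. -/
noncomputable def induceIsoOfImage {W : Type v} {G : SimpleGraph V} {H : SimpleGraph W}
    (f : G ↪g H) {s : Set V} {t : Set W} (h : f '' s = t) : G.induce s ≃g H.induce t where
  toEquiv := (Equiv.Set.image f s f.injective).trans (Equiv.setCongr h)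
  map_rel_iff' := f.map_rel_iff

theorem Collapsible.of_iso {G : SimpleGraph V} (hG : Collapsible G) :
    ∀ {W : Type u} {H : SimpleGraph W}, G ≃g H → Collapsible H := by
  induction hG with
  | point G x hx =>
    intro W H e
    exact .point H (e x) fun y => by rw [← e.apply_symm_apply y, hx (e.symm y)]
  | step G x _ _ ihS ihD =>
    intro W H e
    refine .step H (e x) (ihS (induceIsoOfImage e.toEmbedding ?_))
      (ihD (induceIsoOfImage e.toEmbedding ?_))
    · ext y
      obtain ⟨z, rfl⟩ := e.surjective y
      simpa using e.map_adj_iff.symm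
    · ext y
      obtain ⟨z, rfl⟩ := e.surjective y
      simp

/-- The unit sphere of `x` in the subgraph induced on `s`. -/
noncomputable def unitSphereInduceIso (G : SimpleGraph V) {s : Set V} {x : V} (hx : x ∈ s) :
    (G.induce s).unitSphere ⟨x, hx⟩ ≃g G.induce (s ∩ G.neighborSet x) :=
  induceIsoOfImage (Embedding.induce s) (by ext y; simp [and_comm])

/-- Removal of the vertex `x` from the subgraph induced on `s`. -/
noncomputable def deleteVertexInduceIso (G : SimpleGraph V) {s : Set V} {x : V} (hx : x ∈ s) :
    (G.induce s).deleteVertex ⟨x, hx⟩ ≃g G.induce (s \ {x}) :=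
  induceIsoOfImage (Embedding.induce s) (by ext y; simp [and_comm])

theorem Collapsible.induce_step {G : SimpleGraph V} {s : Set V} {x : V} (hx : x ∈ s)
    (hS : Collapsible (G.induce (s ∩ G.neighborSet x)))
    (hD : Collapsible (G.induce (s \ {x}))) : Collapsible (G.induce s) :=
  .step _ ⟨x, hx⟩ (hS.of_iso (G.unitSphereInduceIso hx).symm)
    (hD.of_iso (G.deleteVertexInduceIso hx).symm)

theorem Homotopic.induce_delete {G : SimpleGraph V} {s : Set V} {x : V} (hx : x ∈ s)
    (hS : Collapsible (G.induce (s ∩ G.neighborSet x))) :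
    Homotopic (G.induce s) (G.induce (s \ {x})) :=
  (Homotopic.delete _ ⟨x, hx⟩ (hS.of_iso (G.unitSphereInduceIso hx).symm)).trans
    (.iso (G.deleteVertexInduceIso hx))

/-- A finite cone is collapsible: the points other than the apex can be removed in any order, as
their unit spheres are again cones with the same apex. -/
theorem collapsible_induce_of_apex [Finite V] (G : SimpleGraph V) (a : V) (s : Set V)
    (ha : a ∈ s) (h : ∀ y ∈ s, y ≠ a → G.Adj y a) : Collapsible (G.induce s) := by
  induction s using WellFoundedLT.induction with
  | ind s ih =>
    by_cases hs : ∃ y ∈ s, y ≠ a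
    · obtain ⟨y, hy, hya⟩ := hs
      refine Collapsible.induce_step hy (ih _ ?_ ⟨ha, h y hy hya⟩ fun z hz => h z hz.1)
        (ih _ ?_ ⟨ha, hya.symm⟩ fun z hz => h z hz.1)
      · exact Set.ssubset_iff_of_subset Set.inter_subset_left |>.2
          ⟨y, hy, fun hy' => G.irrefl hy'.2⟩
      · exact Set.sdiff_singleton_ssubset.2 hy
    · push Not at hs
      exact .point _ ⟨a, ha⟩ fun y => Subtype.ext (hs y y.2)

end Collapse

section Incidence

/-! ### Gluing a graph to a poset of cliques -/

variable {X P : Type u} [PartialOrder P]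

/-- For a family `f` of vertex sets of `K` indexed by a poset `P`: the disjoint union of `K` and
the comparability graph of `P`, in which moreover each vertex `a` of `K` is joined to every index
`p` with `a ∈ f p`. -/
def incidence (K : SimpleGraph X) (f : P → Set X) : SimpleGraph (X ⊕ P) where
  Adj
    | .inl a, .inl b => K.Adj a b
    | .inl a, .inr q => a ∈ f q
    | .inr p, .inl b => b ∈ f p
    | .inr p, .inr q => p ≠ q ∧ (p ≤ q ∨ q ≤ p)
  symm := ⟨by
    rintro (a | p) (b | q) h
    · exact K.symm.symm a b h
    · exact h
    · exact h
    · exact ⟨h.1.symm, h.2.symm⟩⟩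
  loopless := ⟨by
    rintro (a | p) h
    · exact K.irrefl h
    · exact h.1 rfl⟩

variable (K : SimpleGraph X) (f : P → Set X)

@[simp] theorem incidence_inl_inl (a b : X) :
    (K.incidence f).Adj (.inl a) (.inl b) ↔ K.Adj a b := Iff.rfl

@[simp] theorem incidence_inl_inr (a : X) (p : P) :
    (K.incidence f).Adj (.inl a) (.inr p) ↔ a ∈ f p := Iff.rfl

/-- The inclusion of `K` into the glued graph. -/
def incidenceInl : K ↪g K.incidence f where
  toFun := Sum.inl
  inj' := Sum.inl_injective
  map_rel_iff' := Iff.rfl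

/-- The inclusion of the comparability graph into the glued graph. -/
def incidenceInr : fromRel (fun p q : P => p ≤ q) ↪g K.incidence f where
  toFun := Sum.inr
  inj' := Sum.inr_injective
  map_rel_iff' := Iff.rfl

variable [Finite X] [Finite P]

variable {K f} in
/-- The indices can be removed from bottom to top; `U` is the set of those still present. -/
theorem homotopic_incidence_left (hmono : Monotone f) (hne : ∀ p, (f p).Nonempty)
    (hcl : ∀ p, K.IsClique (f p)) (U : Set P) (hU : IsUpperSet U) :
    Homotopic ((K.incidence f).induce (Set.range Sum.inl ∪ Sum.inr '' U))
      ((K.incidence f).induce (Set.range Sum.inl)) := by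
  induction U using WellFoundedLT.induction with
  | ind U ih =>
    rcases U.eq_empty_or_nonempty with rfl | hne'
    · rw [Set.image_empty, Set.union_empty]
      exact .iso Iso.refl
    · obtain ⟨p, hp⟩ := U.toFinite.exists_minimal hne'
      have hpU : p ∈ U := hp.prop
      have hup : IsUpperSet (U \ {p}) := by
        rintro a b hab ⟨ha, hap⟩
        refine ⟨hU hab ha, ?_⟩
        rintro rfl
        exact hap (hp.eq_of_le ha hab)
      obtain ⟨a, ha⟩ := hne p
      refine (Homotopic.induce_delete (x := Sum.inr p) (Or.inr ⟨p, hpU, rfl⟩) ?_).trans ?_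
      · refine collapsible_induce_of_apex _ (Sum.inl a) _ ⟨Or.inl ⟨a, rfl⟩, ha⟩ ?_
        rintro (b | q) ⟨hq, hadj⟩ hne
        · exact hcl p hadj ha fun h => hne (h ▸ rfl)
        · obtain ⟨hpq, hle⟩ := hadj
          have hqU : q ∈ U := by simpa using hq
          exact hmono (hle.elim id fun h => hp.le_of_le hqU h) ha
      · have : (Set.range Sum.inl ∪ Sum.inr '' U) \ {Sum.inr p}
            = (Set.range Sum.inl ∪ Sum.inr '' (U \ {p}) : Set (X ⊕ P)) := by
          ext (b | q) <;> simp
        rw [this]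
        exact ih _ (Set.sdiff_singleton_ssubset.2 hpU) hup

variable {K f} in
/-- A set `A` of common neighbours of a nonempty clique `σ`, together with all indices of sets
that contain `σ`, spans a collapsible graph. -/
theorem collapsible_incidence
    (hmin : ∀ σ : Set X, σ.Nonempty → K.IsClique σ →
      ∃ p, σ ⊆ f p ∧ ∀ q, σ ⊆ f q → p ≤ q)
    (A : Set X) (σ : Set X) (hσ : σ.Nonempty) (hcl : K.IsClique σ)
    (hA : ∀ a ∈ A, ∀ b ∈ σ, K.Adj a b) :
    Collapsible ((K.incidence f).induce (Sum.inl '' A ∪ Sum.inr '' {p | σ ⊆ f p})) := by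
  induction A using WellFoundedLT.induction generalizing σ with
  | ind A ih =>
    rcases A.eq_empty_or_nonempty with rfl | ⟨b, hb⟩
    · obtain ⟨p, hp, hle⟩ := hmin σ hσ hcl
      refine collapsible_induce_of_apex _ (Sum.inr p) _ (Or.inr ⟨p, hp, rfl⟩) ?_
      rintro (c | q) hq hne
      · simp at hq
      · have hq' : σ ⊆ f q := by simpa using hq
        exact ⟨fun h => hne (h ▸ rfl), Or.inr (hle q hq')⟩
    · refine Collapsible.induce_step (x := Sum.inl b) (Or.inl ⟨b, hb, rfl⟩) ?_ ?_
      · have : (Sum.inl '' A ∪ Sum.inr '' {p | σ ⊆ f p}) ∩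
              (K.incidence f).neighborSet (Sum.inl b)
            = Sum.inl '' (A ∩ K.neighborSet b) ∪ Sum.inr '' {p | insert b σ ⊆ f p} := by
          ext (c | q) <;> simp [Set.insert_subset_iff, and_comm]
        rw [this]
        refine ih _ ?_ _ (Set.insert_nonempty _ _) ?_ ?_
        · exact Set.ssubset_iff_of_subset Set.inter_subset_left |>.2
            ⟨b, hb, fun hb' => K.irrefl hb'.2⟩
        · exact hcl.insert fun c hc _ => hA b hb c hc
        · rintro a ⟨ha, hba⟩ c (rfl | hc)
          · exact hba.symm
          · exact hA a ha c hc
      · have : (Sum.inl '' A ∪ Sum.inr '' {p | σ ⊆ f p}) \ {Sum.inl b}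
            = Sum.inl '' (A \ {b}) ∪ Sum.inr '' {p | σ ⊆ f p} := by
          ext (c | q) <;> simp
        rw [this]
        exact ih _ (Set.sdiff_singleton_ssubset.2 hb) σ hσ hcl fun a ha => hA a ha.1

variable {K f} in
/-- The vertices of `K` can be removed in any order; `R` is the set of those still present. -/
theorem homotopic_incidence_right
    (hmin : ∀ σ : Set X, σ.Nonempty → K.IsClique σ →
      ∃ p, σ ⊆ f p ∧ ∀ q, σ ⊆ f q → p ≤ q) (R : Set X) :
    Homotopic ((K.incidence f).induce (Sum.inl '' R ∪ Set.range Sum.inr))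
      ((K.incidence f).induce (Set.range Sum.inr)) := by
  induction R using WellFoundedLT.induction with
  | ind R ih =>
    rcases R.eq_empty_or_nonempty with rfl | ⟨a, ha⟩
    · rw [Set.image_empty, Set.empty_union]
      exact .iso Iso.refl
    · refine (Homotopic.induce_delete (x := Sum.inl a) (Or.inl ⟨a, ha, rfl⟩) ?_).trans ?_
      · have : (Sum.inl '' R ∪ Set.range Sum.inr) ∩ (K.incidence f).neighborSet (Sum.inl a)
            = Sum.inl '' (R ∩ K.neighborSet a) ∪ Sum.inr '' {p | {a} ⊆ f p} := by
          ext (c | q) <;> simp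
        rw [this]
        refine collapsible_incidence hmin _ _ (Set.singleton_nonempty a) (by simp) ?_
        rintro c ⟨-, hc⟩ b rfl
        exact hc.symm
      · have : (Sum.inl '' R ∪ Set.range Sum.inr) \ {Sum.inl a}
            = (Sum.inl '' (R \ {a}) ∪ Set.range Sum.inr : Set (X ⊕ P)) := by
          ext (c | q) <;> simp
        rw [this]
        exact ih _ (Set.sdiff_singleton_ssubset.2 ha)

variable {K f} in
/-- A finite graph `K` is homotopic to the comparability graph of a poset of nonempty cliques of
`K` if every nonempty clique lies in a smallest member of the poset. -/
theorem homotopic_comparability (hmono : Monotone f) (hne : ∀ p, (f p).Nonempty)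
    (hcl : ∀ p, K.IsClique (f p))
    (hmin : ∀ σ : Set X, σ.Nonempty → K.IsClique σ →
      ∃ p, σ ⊆ f p ∧ ∀ q, σ ⊆ f q → p ≤ q) :
    Homotopic K (fromRel (fun p q : P => p ≤ q)) := by
  have hl := homotopic_incidence_left hmono hne hcl Set.univ isUpperSet_univ
  have hr := homotopic_incidence_right hmin Set.univ
  rw [Set.image_univ] at hl hr
  exact ((Homotopic.iso (K.incidenceInl f).isoInduceRange).trans (hl.symm.trans hr)).trans
    (Homotopic.iso (K.incidenceInr f).isoInduceRange).symm

end Incidence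

/-! ### Rectangles in the strong product -/

section Products

variable {V : Type u} {W : Type v} {G : SimpleGraph V} {H : SimpleGraph W}

theorem strongProd_adj {p q : V × W} : (G.strongProd H).Adj p q ↔
    p ≠ q ∧ (p.1 = q.1 ∨ G.Adj p.1 q.1) ∧ (p.2 = q.2 ∨ H.Adj p.2 q.2) := by
  obtain ⟨a, b⟩ := p
  obtain ⟨c, d⟩ := q
  have hG : G.Adj a c → a ≠ c := Adj.ne
  have hH : H.Adj b d → b ≠ d := Adj.ne
  simp only [strongProd, tensorProd, sup_adj, boxProd_adj, ne_eq, Prod.mk.injEq]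
  tauto

theorem IsClique.prod {s : Set V} {t : Set W} (hs : G.IsClique s) (ht : H.IsClique t) :
    (G.strongProd H).IsClique (s ×ˢ t) := by
  rintro p ⟨hp₁, hp₂⟩ q ⟨hq₁, hq₂⟩ hne
  exact strongProd_adj.2 ⟨hne, or_iff_not_imp_left.2 (hs hp₁ hq₁),
    or_iff_not_imp_left.2 (ht hp₂ hq₂)⟩

theorem IsClique.image_fst {σ : Set (V × W)} (h : (G.strongProd H).IsClique σ) :
    G.IsClique (Prod.fst '' σ) := by
  rintro _ ⟨p, hp, rfl⟩ _ ⟨q, hq, rfl⟩ hne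
  exact (strongProd_adj.1 (h hp hq fun e => hne (e ▸ rfl))).2.1.resolve_left hne

theorem IsClique.image_snd {σ : Set (V × W)} (h : (G.strongProd H).IsClique σ) :
    H.IsClique (Prod.snd '' σ) := by
  rintro _ ⟨p, hp, rfl⟩ _ ⟨q, hq, rfl⟩ hne
  exact (strongProd_adj.1 (h hp hq fun e => hne (e ▸ rfl))).2.2.resolve_left hne

end Products

end SimpleGraph

theorem mainTheorem2 {V W : Type*} [Finite V] [Finite W]
    (G : SimpleGraph V) (H : SimpleGraph W) :
    SimpleGraph.Homotopic (G.strongProd H) (G.simplexProd H) := by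
  have hcomp : G.simplexProd H =
      SimpleGraph.fromRel (fun p q : G.Simplex × H.Simplex => p ≤ q) := by
    ext p q
    exact Iff.rfl
  rw [hcomp]
  refine SimpleGraph.homotopic_comparability
    (f := fun p => (p.1.1 : Set V) ×ˢ (p.2.1 : Set W)) ?_ ?_ ?_ ?_
  · exact fun p q h => Set.prod_mono (Finset.coe_subset.2 h.1) (Finset.coe_subset.2 h.2)
  · exact fun p => Set.Nonempty.prod p.1.2.1 p.2.2.1
  · exact fun p => p.1.2.2.prod p.2.2.2
  · intro σ hne hσ
    refine ⟨(⟨(Prod.fst '' σ).toFinite.toFinset, ?_, ?_⟩,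
      ⟨(Prod.snd '' σ).toFinite.toFinset, ?_, ?_⟩), ?_, ?_⟩
    · simpa using hne
    · simpa using hσ.image_fst
    · simpa using hne
    · simpa using hσ.image_snd
    · intro a ha
      simpa using ⟨⟨a.2, ha⟩, ⟨a.1, ha⟩⟩
    · intro q hq
      refine ⟨fun a ha => ?_, fun b hb => ?_⟩
      · obtain ⟨p, hp, rfl⟩ := (Set.Finite.mem_toFinset _).1 ha
        exact (hq hp).1
      · obtain ⟨p, hp, rfl⟩ := (Set.Finite.mem_toFinset _).1 hb
        exact (hq hp).2
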